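/- Let $\ell_1$ and $\ell_\infty$ be the spaces of absolutely summable and of bounded real sequences, and let $S:\ell_1\hookrightarrow\ell_\infty$, $Sx=x$, be the identical embedding. For $n\in\mathbb N$, a non-adaptive randomized algorithm (Monte Carlo method) using $n$ linear functionals is a family of maps $A_n^\omega=\varphi^\omega\circ N^\omega:\ell_1\to\ell_\infty$ indexed by the points $\omega$ of a complete probability space $(\Omega,\mathcal A,\mathbb P)$. Here $N^\omega f=(L_1^\omega(f),\dots,L_n^\omega(f))$ with continuous linear functionals $L_1^\omega,\dots,L_n^\omega$ on $\ell_1$ (some of which may be zero), and $\varphi^\omega:\mathbb R^n\to\ell_\infty$ is an arbitrary, possibly non-linear, map. The following measurability is required: $\omega\mapsto L_k^\omega(f)$ is measurable for all $k$ and all $f\in\ell_1$, and $(\omega,y)\mapsto\|\varphi^\omega(y)-g\|_\infty$ is measurable on $\Omega\times\mathbb R^n$ for all $g\in\ell_\infty$. (This holds in particular if $\omega\mapsto L_k^\omega\in(\ell_1)'$ and $(\omega,y)\mapsto\varphi^\omega(y)\in\ell_\infty$ are measurable with respect to the Borel sets of the norm topologies.) Put $$e^{\mathrm{ran},\mathrm{nonada}}(n,\ell_1\hookrightarrow\ell_\infty):=\inf_{A_n}\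 \sup_{\|f\|_1\le 1}\ \mathbb E\,\|A_n(f)-f\|_\infty ,$$ where the infimum is over all such algorithms. Then the limit as $n\to\infty$ exists and $$\lim_{n\to\infty}e^{\mathrm{ran},\mathrm{nonada}}(n,\ell_1\hookrightarrow\ell_\infty)\ \ge\ \varepsilon_0:=\frac13\Bigl(\frac1{20}-e^{-4}\Bigr)>0 .$$ Hence this embedding is not approximable by non-adaptive Monte Carlo methods, that is, $e^{\mathrm{ran},\mathrm{nonada}}(n,\ell_1\hookrightarrow\ell_\infty)\not\to0$ as $n\to\infty$. -/

import Mathlib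

open MeasureTheory Filter Topology
open scoped ENNReal

universe w u v

/-- A non-adaptive randomized algorithm (Monte Carlo method) `A^ω = φ^ω ∘ N^ω : F → G` of
cardinality `n`: a complete probability space `Ω`, random continuous linear functionals
`L_1^ω, …, L_n^ω` on `F` forming the information map `N^ω f = (L_1^ω f, …, L_n^ω f)`, which are
not allowed to depend on the input, and an arbitrary (in general non-linear) random reconstruction
`φ^ω : ℝⁿ → G`.  Functionals may vanish, so that using at most `n` functionals is covered.

Measurability is imposed in a form which is implied by norm-Borel measurability of
`ω ↦ L_k^ω ∈ F'` and of `φ : Ω × ℝⁿ → G`, which is equivalent to it if `F'` and `G` are separable,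
and which always makes the error `ω ↦ ‖A^ω f - S f‖` measurable: weak-* measurability of the
functionals, and measurability of `φ` with respect to the σ-algebra on `G` generated by the balls
(on `ℓ_∞` this is the σ-algebra generated by the coordinates). -/
structure NonadaptiveAlgorithm (F : Type u) (G : Type v) [NormedAddCommGroup F] [NormedSpace ℝ F]
    [NormedAddCommGroup G] [NormedSpace ℝ G] (n : ℕ) where
  /-- the sample space -/
  Ω : Type w
  [measurableSpace : MeasurableSpace Ω]
  /-- the probability measure -/
  P : Measure Ω
  [isProbabilityMeasure : IsProbabilityMeasure P]
  [isComplete : P.IsComplete]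
  /-- the random linear functionals -/
  L : Fin n → Ω → (F →L[ℝ] ℝ)
  measurable_L : ∀ k f, Measurable fun ω => L k ω f
  /-- the random reconstruction map -/
  φ : Ω → (Fin n → ℝ) → G
  measurable_φ : ∀ g : G, Measurable fun p : Ω × (Fin n → ℝ) => ‖φ p.1 p.2 - g‖

namespace NonadaptiveAlgorithm

variable {F : Type u} {G : Type v} [NormedAddCommGroup F] [NormedSpace ℝ F]
  [NormedAddCommGroup G] [NormedSpace ℝ G] {n : ℕ}

/-- The output `A^ω f = φ^ω (L_1^ω f, …, L_n^ω f)`. -/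
def output (A : NonadaptiveAlgorithm.{w} F G n) (ω : A.Ω) (f : F) : G :=
  A.φ ω fun k => A.L k ω f

/-- The expected error `E ‖A f - S f‖` at the input `f`, with values in `[0, ∞]`. -/
noncomputable def errorAt (A : NonadaptiveAlgorithm.{w} F G n) (S : F →L[ℝ] G) (f : F) : ℝ≥0∞ :=
  letI := A.measurableSpace
  ∫⁻ ω, ‖A.output ω f - S f‖ₑ ∂A.P

end NonadaptiveAlgorithm

/-- The minimal non-adaptive Monte Carlo error
`e^{ran,nonada}(n, S) = inf_A sup_{‖f‖ ≤ 1} E ‖A f - S f‖`. -/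
noncomputable def nonadaptiveRanError {F : Type u} {G : Type v} [NormedAddCommGroup F]
    [NormedSpace ℝ F] [NormedAddCommGroup G] [NormedSpace ℝ G] (S : F →L[ℝ] G) (n : ℕ) : ℝ≥0∞ :=
  ⨅ A : NonadaptiveAlgorithm.{w} F G n, ⨆ f : F, ⨆ _ : ‖f‖ ≤ 1, A.errorAt S f

/-- `S` is approximable by non-adaptive Monte Carlo methods: `e^{ran,nonada}(n, S) → 0`. -/
def IsApproximableNonadaptive {F : Type u} {G : Type v} [NormedAddCommGroup F]
    [NormedSpace ℝ F] [NormedAddCommGroup G] [NormedSpace ℝ G] (S : F →L[ℝ] G) : Prop :=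
  Tendsto (fun n : ℕ => nonadaptiveRanError.{w} S n) atTop (𝓝 0)

/-- The identical embedding `ℓ_1 ↪ ℓ_∞` of real sequence spaces. -/
noncomputable def l1EmbLinfty : lp (fun _ : ℕ => ℝ) 1 →L[ℝ] lp (fun _ : ℕ => ℝ) ∞ :=
  LinearMap.mkContinuous
    { toFun := fun x => ⟨x, (lp.memℓp x).of_exponent_ge le_top⟩
      map_add' := fun _ _ => rfl
      map_smul' := fun _ _ => rfl }
    1 (fun x => by
      rw [one_mul]
      exact lp.norm_le_of_forall_le (norm_nonneg x)
        fun i => lp.norm_apply_le_norm one_ne_zero x i)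

/-- The constant `ε₀ = (1/20 - e⁻⁴) / 3 ≈ 0.01056`. -/
noncomputable def epsilonZero : ℝ := (1 / 3) * (1 / 20 - Real.exp (-4))

/-! The hard inputs hide a spike `e_i / 2` in noise: uniform amplitudes on `k` coordinates `J`, of
total `ℓ_1` size at most `1/2`. Fix the information map `T`. If `T e_i` and `T e_{i'}` are
combinations of the `T e_{J j}` with nearly equal coefficients, then replacing `i` by `i'` is undone
by a small shift of the noise (`map_noisySpike_eq`). Such a shift maps most of the noise cube into
itself, so an arbitrary reconstruction errs substantially at one of the two spikes
(`le_noiseError_add_noiseError`).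

Coefficients bounded by some `C(n)` fall into a number of small cells that does not depend on `T`.
By pigeonhole, for each `J` only boundedly many spanned `i` have small error
(`card_small_noiseError_le`). Boundedness comes from `exists_bounded_spanner`: in any `k + 1`
vectors of `ℝⁿ` all but `n` are boundedly spanned by the rest, so by symmetry a random pair `(i, J)`
fails with probability at most `n / (k + 1)`.

With `k` and the number `m` of coordinates large in terms of `n` alone, half of all pairs have error
at least `1/16`. Averaging over `ω` gives `1/32` for every `n`, which exceeds `ε₀ < 1/60`. -/

/-! ### Bounded spanning sets and exchangeability. -/

/-- Among finitely many vectors in `ℝⁿ` there are at most `n` whose combinations with coefficients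
bounded by a constant depending only on `n` produce all the others. -/
theorem exists_bounded_spanner (n : ℕ) : ∃ C : ℝ, 0 ≤ C ∧
    ∀ (k : ℕ) (x : Fin k → Fin n → ℝ), ∃ B : Finset (Fin k), B.card ≤ n ∧
      ∀ p, ∃ t : Fin k → ℝ, (∀ j ∉ B, t j = 0) ∧ (∀ j, |t j| ≤ C) ∧ x p = ∑ j, t j • x j := by
  induction n with
  | zero =>
    refine ⟨0, le_rfl, fun k x => ⟨∅, by simp, fun p => ⟨0, by simp, by simp, ?_⟩⟩⟩
    exact Subsingleton.elim _ _
  | succ n ih =>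
    obtain ⟨C, hC, h⟩ := ih
    refine ⟨C + (1 + n * C), by positivity, fun k x => ?_⟩
    rcases isEmpty_or_nonempty (Fin k) with hk | hk
    · exact ⟨∅, by simp, fun p => isEmptyElim p⟩
    -- Gaussian elimination of the first coordinate with the largest pivot, which keeps all ratios
    -- at most 1 in modulus.
    obtain ⟨b, hb⟩ := Finite.exists_max fun p => |x p 0|
    set r : Fin k → ℝ := fun p => x p 0 / x b 0 with hr
    have hr1 : ∀ p, |r p| ≤ 1 := fun p => by
      rw [hr, abs_div]
      exact div_le_one_of_le₀ (hb p) (abs_nonneg _)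
    -- A zero pivot forces all first coordinates to vanish, so the identity survives division by
    -- zero.
    have hr0 : ∀ p, x p 0 = r p * x b 0 := fun p => by
      by_cases h0 : x b 0 = 0
      · have := hb p
        simp only [h0, abs_zero, abs_nonpos_iff] at this
        simp [h0, this]
      · simp [hr, h0]
    obtain ⟨B, hBc, hB⟩ := h k fun p i => x p i.succ - r p * x b i.succ
    refine ⟨insert b B, (Finset.card_insert_le _ _).trans (by lia), fun p => ?_⟩
    obtain ⟨t, ht0, htC, ht⟩ := hB p
    -- Undoing the elimination leaves this multiple of `x b`; at most `n` terms of the sum are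
    -- nonzero.
    set c : ℝ := r p - ∑ j, t j * r j with hc
    have hsum : |∑ j, t j * r j| ≤ n * C := by
      have : ∑ j, t j * r j = ∑ j ∈ B, t j * r j :=
        (Finset.sum_subset (Finset.subset_univ _) fun j _ hj => by simp [ht0 j hj]).symm
      rw [this]
      calc |∑ j ∈ B, t j * r j| ≤ ∑ j ∈ B, |t j * r j| := Finset.abs_sum_le_sum_abs _ _
        _ ≤ ∑ _j ∈ B, C := Finset.sum_le_sum fun j _ => by
            rw [abs_mul]
            exact (mul_le_mul (htC j) (hr1 j) (abs_nonneg _) hC).trans_eq (mul_one C)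
        _ = B.card * C := by simp
        _ ≤ n * C := by gcongr
    have hcle : |c| ≤ 1 + n * C := (abs_sub _ _).trans (add_le_add (hr1 p) hsum)
    refine ⟨fun j => t j + if j = b then c else 0, fun j hj => ?_, fun j => ?_, ?_⟩
    · simp only [Finset.mem_insert, not_or] at hj
      simp [hj.1, ht0 j hj.2]
    · refine (abs_add_le _ _).trans (add_le_add (htC j) ?_)
      split_ifs
      · exact hcle
      · simp; positivity
    · have key : ∀ i, x p i - r p * x b i = ∑ j, t j * (x j i - r j * x b i) := by
        intro i
        refine Fin.cases ?_ (fun i => ?_) i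
        · rw [← hr0 p, sub_self]
          exact (Finset.sum_eq_zero fun j _ => by rw [← hr0 j]; simp).symm
        · simpa [Finset.sum_apply] using congrFun ht i
      funext i
      have := key i
      simp only [mul_sub, Finset.sum_sub_distrib, ← mul_assoc, ← Finset.sum_mul] at this
      rw [Finset.sum_apply]
      simp only [Pi.smul_apply, smul_eq_mul, add_mul, Finset.sum_add_distrib, ite_mul, zero_mul,
        Finset.sum_ite_eq', Finset.mem_univ, if_true, hc]
      linarith

/-- If in every `(k+1)`-tuple at most `n` entries are exceptional relative to the remaining ones,
then at most a fraction `n / (k+1)` of all pairs (entry, remaining `k`-tuple) is exceptional. -/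
theorem card_exceptional_le {α : Type*} [Fintype α] (n k : ℕ) (Q : α → (Fin k → α) → Prop)
    [∀ i J, Decidable (Q i J)]
    (h : ∀ s : Fin (k + 1) → α,
      (Finset.univ.filter fun p : Fin (k + 1) => Q (s p) (p.removeNth s)).card ≤ n) :
    (k + 1) * (Finset.univ.filter fun z : α × (Fin k → α) => Q z.1 z.2).card
      ≤ n * Fintype.card α ^ (k + 1) := by
  -- Inserting the entry at position `p` is a bijection from pairs to tuples, so every position
  -- contributes the same count.
  have e : ∀ p : Fin (k + 1),
      ∑ s : Fin (k + 1) → α, (if Q (s p) (p.removeNth s) then 1 else 0)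
        = ∑ z : α × (Fin k → α), if Q z.1 z.2 then 1 else 0 := fun p =>
    Fintype.sum_equiv (Fin.insertNthEquiv (fun _ => α) p).symm _ _ fun s => rfl
  calc (k + 1) * (Finset.univ.filter fun z : α × (Fin k → α) => Q z.1 z.2).card
      = ∑ p : Fin (k + 1), ∑ s : Fin (k + 1) → α,
          (if Q (s p) (p.removeNth s) then 1 else 0) := by
        rw [Finset.sum_congr rfl fun p _ => e p, Finset.card_filter]
        simp
    _ = ∑ s : Fin (k + 1) → α, ∑ p : Fin (k + 1),
          (if Q (s p) (p.removeNth s) then 1 else 0) := Finset.sum_comm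
    _ ≤ ∑ _s : Fin (k + 1) → α, n := Finset.sum_le_sum fun s _ => by
        rw [← Finset.card_filter]
        exact h s
    _ = n * Fintype.card α ^ (k + 1) := by simp [mul_comm]

/-! ### Noisy spikes. -/

/-- The input `e_i / 2 + (2k)⁻¹ ∑ j, u j e_{J j}` in `ℓ_1`: a spike at `i`, and noise of amplitude
`u` on the coordinates `J`. -/
noncomputable def noisySpike {k : ℕ} (i : ℕ) (J : Fin k → ℕ) (u : Fin k → ℝ) :
    lp (fun _ : ℕ => ℝ) 1 :=
  (1 / 2 : ℝ) • lp.single 1 i (1 : ℝ) + ∑ j, (u j / (2 * k)) • lp.single 1 (J j) (1 : ℝ)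

theorem continuous_noisySpike {k : ℕ} (i : ℕ) (J : Fin k → ℕ) :
    Continuous (noisySpike i J) := by
  unfold noisySpike
  fun_prop

theorem norm_noisySpike_le {k : ℕ} (i : ℕ) (J : Fin k → ℕ) {u : Fin k → ℝ}
    (hu : u ∈ Set.Icc (0 : Fin k → ℝ) 1) : ‖noisySpike i J u‖ ≤ 1 := by
  have h1 : ∀ a : ℕ, ‖(lp.single 1 a (1 : ℝ) : lp (fun _ : ℕ => ℝ) 1)‖ = 1 := fun a => by
    rw [lp.norm_single one_pos, norm_one]
  have h2 : ∀ j, ‖(u j / (2 * k)) • (lp.single 1 (J j) (1 : ℝ) : lp (fun _ : ℕ => ℝ) 1)‖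
      ≤ 1 / (2 * k) := fun j => by
    have h0 : 0 ≤ u j := hu.1 j
    have h1' : u j ≤ 1 := hu.2 j
    rw [norm_smul, h1, mul_one, Real.norm_of_nonneg (by positivity)]
    gcongr
  have h3 : (k : ℝ) * (1 / (2 * k)) ≤ 1 / 2 := by
    rcases Nat.eq_zero_or_pos k with rfl | hk
    · simp
    · have : (0 : ℝ) < k := by exact_mod_cast hk
      apply le_of_eq
      field_simp
  calc ‖noisySpike i J u‖ ≤ 1 / 2 + k * (1 / (2 * k)) := by
        refine (norm_add_le _ _).trans (add_le_add ?_ ?_)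
        · rw [norm_smul, h1]
          norm_num
        · refine (norm_sum_le_of_le _ fun j _ => h2 j).trans ?_
          simp
    _ ≤ 1 := by linarith

/-- Linear information cannot tell apart two spikes with the same image up to noise, if the noise
compensates the difference. -/
theorem map_noisySpike_eq {k : ℕ} (hk : k ≠ 0) {V : Type*} [AddCommGroup V] [Module ℝ V]
    (T : lp (fun _ : ℕ => ℝ) 1 →ₗ[ℝ] V) {i i' : ℕ} {J : Fin k → ℕ} {t t' : Fin k → ℝ}
    (h : T (lp.single 1 i 1) = ∑ j, t j • T (lp.single 1 (J j) 1))
    (h' : T (lp.single 1 i' 1) = ∑ j, t' j • T (lp.single 1 (J j) 1)) (u : Fin k → ℝ) :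
    T (noisySpike i J u) = T (noisySpike i' J (u + fun j => k * (t j - t' j))) := by
  have hk' : (k : ℝ) ≠ 0 := by exact_mod_cast hk
  simp only [noisySpike, map_add, map_smul, map_sum, h, h', Finset.smul_sum, smul_smul,
    ← Finset.sum_add_distrib, ← add_smul, Pi.add_apply]
  refine Finset.sum_congr rfl fun j _ => ?_
  congr 1
  field_simp
  ring

theorem l1EmbLinfty_apply (x : lp (fun _ : ℕ => ℝ) 1) (a : ℕ) : l1EmbLinfty x a = x a := rfl

theorem noisySpike_apply {k : ℕ} (i : ℕ) (J : Fin k → ℕ) (u : Fin k → ℝ) (a : ℕ) :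
    noisySpike i J u a = (if a = i then 1 / 2 else 0) +
      ∑ j, u j / (2 * k) * (if a = J j then 1 else 0) := by
  have h : ∀ b : ℕ, (lp.single 1 b (1 : ℝ) : lp (fun _ : ℕ => ℝ) 1) a = if a = b then 1 else 0 :=
    fun b => by
      rw [lp.single_apply, Pi.single_apply]
  rw [noisySpike, lp.coeFn_add, Pi.add_apply, lp.coeFn_sum, Finset.sum_apply]
  simp only [lp.coeFn_smul, Pi.smul_apply, smul_eq_mul, h]
  simp

/-- At coordinate `i` the common noise cancels and the shift `v` contributes at most `1/8`, even if
`J` repeats or hits `i`, against the spike height `1/2`. -/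
theorem le_norm_noisySpike_sub {k : ℕ} {i i' : ℕ} (hi : i ≠ i') (J : Fin k → ℕ)
    (u : Fin k → ℝ) {v : Fin k → ℝ} (hv : ∀ j, |v j| ≤ 1 / (4 * k)) :
    1 / 4 ≤ ‖l1EmbLinfty (noisySpike i J u) - l1EmbLinfty (noisySpike i' J (u + v))‖ := by
  refine le_trans ?_ (lp.norm_apply_le_norm ENNReal.top_ne_zero _ i)
  rw [lp.coeFn_sub, Pi.sub_apply, l1EmbLinfty_apply, l1EmbLinfty_apply, noisySpike_apply,
    noisySpike_apply, if_pos rfl, if_neg hi]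
  have hsum : |∑ j, v j / (2 * k) * (if i = J j then 1 else 0)| ≤ 1 / 8 := by
    rcases Nat.eq_zero_or_pos k with rfl | hk
    · simp
    have hk' : (1 : ℝ) ≤ k := by exact_mod_cast hk
    calc |∑ j, v j / (2 * k) * (if i = J j then 1 else 0)|
        ≤ ∑ _j : Fin k, 1 / (4 * (k : ℝ)) / (2 * k) := by
          refine (Finset.abs_sum_le_sum_abs _ _).trans (Finset.sum_le_sum fun j _ => ?_)
          have : |v j / (2 * k)| ≤ 1 / (4 * (k : ℝ)) / (2 * k) := by
            rw [abs_div, abs_of_nonneg (by positivity : (0 : ℝ) ≤ 2 * k)]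
            gcongr
            exact hv j
          split_ifs
          · simpa using this
          · simp only [mul_zero, abs_zero]
            positivity
      _ = 1 / (8 * k) := by
          simp only [Finset.sum_const, Finset.card_univ, Fintype.card_fin, nsmul_eq_mul]
          field_simp
          norm_num
      _ ≤ 1 / 8 := by
          apply one_div_le_one_div_of_le <;> linarith
  have hs : ∑ j, (u + v) j / (2 * k) * (if i = J j then (1 : ℝ) else 0) =
      ∑ j, u j / (2 * k) * (if i = J j then 1 else 0) +
        ∑ j, v j / (2 * k) * (if i = J j then 1 else 0) := by
    rw [← Finset.sum_add_distrib]
    exact Finset.sum_congr rfl fun j _ => by rw [Pi.add_apply]; ring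
  rw [hs, Real.norm_eq_abs]
  refine le_trans ?_ (le_abs_self _)
  have := (abs_le.mp hsum).2
  linarith

/-! ### Indistinguishable spikes. -/

/-- The error, averaged over the noise, of a reconstruction map `g` using the information `T`. -/
noncomputable def noiseError {k : ℕ} {V : Type*} (T : lp (fun _ : ℕ => ℝ) 1 → V)
    (g : V → lp (fun _ : ℕ => ℝ) ∞) (i : ℕ) (J : Fin k → ℕ) : ℝ≥0∞ :=
  ∫⁻ u in Set.Icc (0 : Fin k → ℝ) 1,
    ‖g (T (noisySpike i J u)) - l1EmbLinfty (noisySpike i J u)‖ₑ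

theorem half_le_volume_core {k : ℕ} (hk : k ≠ 0) :
    1 / 2 ≤ volume (Set.Icc (fun _ : Fin k => (1 : ℝ) / (4 * k)) fun _ => 1 - 1 / (4 * k)) := by
  have hk' : (1 : ℝ) ≤ k := by exact_mod_cast Nat.one_le_iff_ne_zero.mpr hk
  rw [Real.volume_Icc_pi, Finset.prod_const, Finset.card_univ, Fintype.card_fin,
    show (1 / 2 : ℝ≥0∞) = ENNReal.ofReal (1 / 2) by
      rw [ENNReal.ofReal_div_of_pos two_pos]; simp]
  have hx : (1 : ℝ) / (4 * k) ≤ 1 / 4 := by apply one_div_le_one_div_of_le <;> linarith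
  rw [← ENNReal.ofReal_pow (by linarith)]
  apply ENNReal.ofReal_le_ofReal
  -- Bernoulli: `(1 - 1/(2k))^k ≥ 1/2`.
  have := one_add_mul_le_pow (a := -(2 * (1 / (4 * (k : ℝ))))) (by linarith) k
  have e : (k : ℝ) * -(2 * (1 / (4 * (k : ℝ)))) = -(1 / 2) := by
    field_simp; norm_num
  rw [e] at this
  rw [show (1 : ℝ) - 1 / (4 * k) - 1 / (4 * k) = 1 + -(2 * (1 / (4 * k))) by ring]
  linarith

/-- For `u` in the core cube, both `u` and `u + v` are admissible noise. The two inputs give the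
same output, so the triangle inequality bounds the sum of their errors by `1/4` from below, on a set
of volume at least `1/2`. -/
theorem le_noiseError_add_noiseError {k : ℕ} (hk : k ≠ 0) {V : Type*} [AddCommGroup V]
    [Module ℝ V] (T : lp (fun _ : ℕ => ℝ) 1 →ₗ[ℝ] V) (g : V → lp (fun _ : ℕ => ℝ) ∞)
    {i i' : ℕ} (hi : i ≠ i') {J : Fin k → ℕ} {t t' : Fin k → ℝ}
    (h : T (lp.single 1 i 1) = ∑ j, t j • T (lp.single 1 (J j) 1))
    (h' : T (lp.single 1 i' 1) = ∑ j, t' j • T (lp.single 1 (J j) 1))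
    (ht : ∀ j, |t j - t' j| ≤ 1 / (4 * k ^ 2))
    (hm : Measurable fun u =>
      ‖g (T (noisySpike i J u)) - l1EmbLinfty (noisySpike i J u)‖ₑ) :
    1 / 8 ≤ noiseError T g i J + noiseError T g i' J := by
  have hk0 : (0 : ℝ) < k := by exact_mod_cast Nat.pos_of_ne_zero hk
  set v : Fin k → ℝ := fun j => k * (t j - t' j) with hv
  have hvle : ∀ j, |v j| ≤ 1 / (4 * k) := fun j => by
    rw [hv, abs_mul, abs_of_pos hk0]
    refine (mul_le_mul_of_nonneg_left (ht j) hk0.le).trans_eq ?_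
    field_simp
  set F : ℕ → (Fin k → ℝ) → ℝ≥0∞ := fun i u =>
    ‖g (T (noisySpike i J u)) - l1EmbLinfty (noisySpike i J u)‖ₑ with hF
  set core := Set.Icc (fun _ : Fin k => (1 : ℝ) / (4 * k)) fun _ => 1 - 1 / (4 * k) with hcore
  have hpos : (0 : ℝ) < 1 / (4 * k) := by positivity
  have h1 : ∫⁻ u in core, F i u ≤ noiseError T g i J :=
    lintegral_mono_set (Set.Icc_subset_Icc (fun j => hpos.le) fun j => by
      simp only [Pi.one_apply]; linarith)
  have h2 : ∫⁻ u in core, F i' (u + v) ≤ noiseError T g i' J := by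
    rw [noiseError, ← lintegral_indicator measurableSet_Icc,
      ← lintegral_indicator measurableSet_Icc]
    -- Translation invariance of Lebesgue measure: the core shifted by `v` stays in the unit cube.
    refine le_trans (lintegral_mono fun u => ?_) (lintegral_add_right_eq_self _ v).le
    by_cases hu : u ∈ core
    swap
    · rw [Set.indicator_of_notMem hu]
      exact zero_le
    rw [Set.indicator_of_mem hu, Set.indicator_of_mem]
    refine ⟨fun j => ?_, fun j => ?_⟩
    · have a := hu.1 j
      have b := (abs_le.mp (hvle j)).1
      simp only [Pi.zero_apply, Pi.add_apply] at a ⊢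
      linarith
    · have a := hu.2 j
      have b := (abs_le.mp (hvle j)).2
      simp only [Pi.one_apply, Pi.add_apply] at a ⊢
      linarith
  refine le_trans ?_ (add_le_add h1 h2)
  rw [← lintegral_add_left hm]
  calc (1 / 8 : ℝ≥0∞) = 1 / 4 * (1 / 2) := by
        rw [one_div, one_div, one_div, ← ENNReal.mul_inv (by simp) (by simp)]
        norm_num
    _ ≤ 1 / 4 * volume core := by gcongr; exact half_le_volume_core hk
    _ = ∫⁻ _u in core, 1 / 4 := by rw [setLIntegral_const]
    _ ≤ ∫⁻ u in core, F i u + F i' (u + v) := by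
        refine lintegral_mono fun u => ?_
        simp only [hF]
        rw [map_noisySpike_eq hk T h h' u, ← ofReal_norm, ← ofReal_norm,
          ← ENNReal.ofReal_add (norm_nonneg _) (norm_nonneg _),
          show (1 / 4 : ℝ≥0∞) = ENNReal.ofReal (1 / 4) by
            rw [ENNReal.ofReal_div_of_pos (by norm_num)]; simp]
        apply ENNReal.ofReal_le_ofReal
        refine (le_norm_noisySpike_sub hi J u hvle).trans ?_
        rw [norm_sub_rev _ (l1EmbLinfty (noisySpike i J u))]
        exact norm_sub_le_norm_sub_add_norm_sub _ _ _

/-! ### Counting spikes with small error. -/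

/-- The number of cells of side `(2k)⁻²` needed to cover the cube `[-C, C]^k`. -/
noncomputable def cellCount (C : ℝ) (k : ℕ) : ℕ :=
  (Fintype.piFinset fun _ : Fin k =>
    Finset.Icc ⌊-C * (4 * k ^ 2)⌋ ⌊C * (4 * k ^ 2)⌋).card

theorem cellCount_pos {C : ℝ} (hC : 0 ≤ C) (k : ℕ) : 0 < cellCount C k := by
  refine Finset.card_pos.mpr ⟨fun _ => 0, Fintype.mem_piFinset.mpr fun _ => ?_⟩
  rw [Finset.mem_Icc]
  constructor
  · rw [← Int.floor_zero (R := ℝ)]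
    apply Int.floor_le_floor
    have : 0 ≤ C * (4 * (k : ℝ) ^ 2) := by positivity
    linarith
  · exact Int.floor_nonneg.mpr (by positivity)

/-- The information on the spike at `i` is a combination of that on the spikes at `J`, with
coefficients bounded by `C`. -/
def BoundedlySpanned {k : ℕ} {V : Type*} [AddCommGroup V] [Module ℝ V] (C : ℝ)
    (T : lp (fun _ : ℕ => ℝ) 1 →ₗ[ℝ] V) (i : ℕ) (J : Fin k → ℕ) : Prop :=
  ∃ t : Fin k → ℝ, (∀ j, |t j| ≤ C) ∧
    T (lp.single 1 i 1) = ∑ j, t j • T (lp.single 1 (J j) 1)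

theorem card_small_noiseError_le {k : ℕ} (hk : k ≠ 0) {V : Type*} [AddCommGroup V]
    [Module ℝ V] (C : ℝ) (T : lp (fun _ : ℕ => ℝ) 1 →ₗ[ℝ] V) (g : V → lp (fun _ : ℕ => ℝ) ∞)
    (J : Fin k → ℕ)
    (hm : ∀ i, Measurable fun u =>
      ‖g (T (noisySpike i J u)) - l1EmbLinfty (noisySpike i J u)‖ₑ)
    (I : Finset ℕ) (hI : ∀ i ∈ I, BoundedlySpanned C T i J ∧ noiseError T g i J < 1 / 16) :
    I.card ≤ cellCount C k := by
  have hk0 : (0 : ℝ) < k := by exact_mod_cast Nat.pos_of_ne_zero hk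
  choose! t ht using fun i hi => (hI i hi).1
  -- Pigeonhole: two spikes in one coefficient cell would have errors summing to less than `1/8`.
  refine Finset.card_le_card_of_injOn (fun i j => ⌊t i j * (4 * k ^ 2)⌋) (fun i hi => ?_) ?_
  · refine Finset.mem_coe.mpr (Fintype.mem_piFinset.mpr fun j => Finset.mem_Icc.mpr ?_)
    have := abs_le.mp ((ht i hi).1 j)
    exact ⟨Int.floor_le_floor (by gcongr; exact this.1),
      Int.floor_le_floor (by gcongr; exact this.2)⟩
  · intro i hi i' hi' hii
    by_contra hne
    have hd : ∀ j, |t i j - t i' j| ≤ 1 / (4 * k ^ 2) := fun j => by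
      have := (Int.abs_sub_lt_one_of_floor_eq_floor (congrFun hii j)).le
      rw [← sub_mul, abs_mul, abs_of_pos (by positivity : (0 : ℝ) < 4 * k ^ 2)] at this
      rwa [le_div_iff₀ (by positivity)]
    have h := le_noiseError_add_noiseError hk T g hne (ht i hi).2 (ht i' hi').2 hd (hm i)
    have h2 := ENNReal.add_lt_add (hI i hi).2 (hI i' hi').2
    refine absurd (h.trans_lt h2) (not_lt.mpr (le_of_eq ?_))
    rw [ENNReal.div_add_div_same]
    rw [ENNReal.div_eq_div_iff (by simp) (by simp) (by simp) (by simp)]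
    norm_num

/-- For every number `n` of functionals there is a finite family of noisy spikes whose average error
is bounded below for every information map and every reconstruction. -/
theorem exists_le_sum_noiseError (n : ℕ) : ∃ k m : ℕ, 0 < m ∧
    ∀ (T : lp (fun _ : ℕ => ℝ) 1 →ₗ[ℝ] (Fin n → ℝ)) (g : (Fin n → ℝ) → lp (fun _ : ℕ => ℝ) ∞),
      (∀ (i : ℕ) (J : Fin k → ℕ), Measurable fun u =>
        ‖g (T (noisySpike i J u)) - l1EmbLinfty (noisySpike i J u)‖ₑ) →
      ((m ^ (k + 1) : ℕ) : ℝ≥0∞) * (1 / 32) ≤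
        ∑ z : Fin m × (Fin k → Fin m), noiseError T g z.1 fun j => z.2 j := by
  classical
  obtain ⟨C, hC, hspan⟩ := exists_bounded_spanner n
  -- Makes `n / (k + 1)` smaller than `1/4`.
  set k := 4 * n + 3 with hk
  set M := cellCount C k with hM
  have hM0 : 0 < M := cellCount_pos hC k
  -- For each `J`, at most `M` of the `4 * M` spikes are spanned with small error: again a quarter.
  refine ⟨k, 4 * M, by lia, fun T g hm => ?_⟩
  set m := 4 * M with hm4
  have hbad : 4 * (Finset.univ.filter fun z : Fin m × (Fin k → Fin m) =>
      ¬ BoundedlySpanned C T z.1 fun j => z.2 j).card ≤ m ^ (k + 1) := by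
    have := card_exceptional_le n k
      (fun (i : Fin m) (J : Fin k → Fin m) => ¬ BoundedlySpanned C T i fun j => J j) fun s => by
        obtain ⟨B, hBn, hB⟩ := hspan (k + 1) fun p => T (lp.single 1 (s p : ℕ) 1)
        refine (Finset.card_le_card fun p hp => ?_).trans hBn
        by_contra hpB
        obtain ⟨t, ht0, htC, ht⟩ := hB p
        -- Outside `B` the coefficient of `p` itself is zero, so the other entries alone span.
        refine (Finset.mem_filter.mp hp).2 ⟨p.removeNth t, fun j => htC _, ?_⟩
        rw [ht, Fin.sum_univ_succAbove _ p, ht0 p hpB, zero_smul, zero_add]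
        rfl
    rw [Fintype.card_fin] at this
    refine le_of_mul_le_mul_left ?_ (Nat.succ_pos n)
    calc (n + 1) * (4 * _) = (k + 1) * _ := by rw [hk]; ring
      _ ≤ n * m ^ (k + 1) := this
      _ ≤ (n + 1) * m ^ (k + 1) := by gcongr; lia
  have hgood : (Finset.univ.filter fun z : Fin m × (Fin k → Fin m) =>
      BoundedlySpanned C T z.1 (fun j => z.2 j) ∧
        noiseError T g z.1 (fun j => z.2 j) < 1 / 16).card ≤ m ^ k * M := by
    rw [Finset.card_filter, Fintype.sum_prod_type_right]
    calc _ ≤ ∑ _J : Fin k → Fin m, M := Finset.sum_le_sum fun J _ => by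
          rw [← Finset.card_filter, ← Finset.card_map Fin.valEmbedding]
          refine card_small_noiseError_le (by lia) C T g (fun j => J j) (fun i => hm i _) _ ?_
          intro i hi
          obtain ⟨a, ha, rfl⟩ := Finset.mem_map.mp hi
          exact (Finset.mem_filter.mp ha).2
      _ = m ^ k * M := by simp
  set A := Finset.univ.filter fun z : Fin m × (Fin k → Fin m) =>
    1 / 16 ≤ noiseError T g z.1 (fun j => z.2 j) with hA
  have hcard : m ^ (k + 1) ≤ A.card * 2 := by
    have hcover : (Finset.univ : Finset (Fin m × (Fin k → Fin m))) ⊆ A ∪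
        ((Finset.univ.filter fun z : Fin m × (Fin k → Fin m) =>
          ¬ BoundedlySpanned C T z.1 fun j => z.2 j) ∪
        (Finset.univ.filter fun z : Fin m × (Fin k → Fin m) =>
          BoundedlySpanned C T z.1 (fun j => z.2 j) ∧
            noiseError T g z.1 (fun j => z.2 j) < 1 / 16)) := by
      intro z _
      simp only [hA, Finset.mem_union, Finset.mem_filter, Finset.mem_univ, true_and]
      rcases le_or_gt (1 / 16) (noiseError T g z.1 fun j => z.2 j) with h | h
      · exact Or.inl h
      · tauto
    have h := (Finset.card_le_card hcover).trans ((Finset.card_union_le _ _).trans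
      (Nat.add_le_add_left (Finset.card_union_le _ _) _))
    have hu : (Finset.univ : Finset (Fin m × (Fin k → Fin m))).card = m ^ (k + 1) := by
      simp [pow_succ, mul_comm]
    rw [hu] at h
    have hp : m ^ (k + 1) = 4 * (m ^ k * M) := by rw [pow_succ]; simp only [hm4]; ring
    lia
  calc ((m ^ (k + 1) : ℕ) : ℝ≥0∞) * (1 / 32) ≤ ((A.card * 2 : ℕ) : ℝ≥0∞) * (1 / 32) := by
        gcongr
    _ = ∑ _z ∈ A, (1 / 16 : ℝ≥0∞) := by
        rw [Finset.sum_const, nsmul_eq_mul, Nat.cast_mul, mul_assoc]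
        congr 1
        rw [show (32 : ℝ≥0∞) = 2 * 16 by norm_num, one_div, one_div,
          ENNReal.mul_inv (by simp) (by simp), ← mul_assoc, Nat.cast_ofNat,
          ENNReal.mul_inv_cancel (by simp) (by simp), one_mul]
    _ ≤ ∑ z ∈ A, noiseError T g z.1 fun j => z.2 j :=
        Finset.sum_le_sum fun z hz => (Finset.mem_filter.mp hz).2
    _ ≤ _ := Finset.sum_le_sum_of_subset (Finset.subset_univ _)

/-! ### Measurability, monotonicity in `n` and finiteness. -/

namespace NonadaptiveAlgorithm

variable {F : Type u} {G : Type v} [NormedAddCommGroup F] [NormedSpace ℝ F]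
  [NormedAddCommGroup G] [NormedSpace ℝ G] {n : ℕ}

/-- The information map `N^ω`. -/
noncomputable def info (A : NonadaptiveAlgorithm.{w} F G n) (ω : A.Ω) : F →ₗ[ℝ] (Fin n → ℝ) :=
  LinearMap.pi fun k => (A.L k ω).toLinearMap

/-- Needed for Fubini. Measurability of `φ` is given only for each fixed `g`; since the distance is
continuous in `g = S (f x)`, a Carathéodory argument makes it jointly measurable without
separability of `G`. -/
theorem measurable_error_comp (A : NonadaptiveAlgorithm.{w} F G n) (S : F →L[ℝ] G) {X : Type*}
    [TopologicalSpace X] [TopologicalSpace.MetrizableSpace X] [SecondCountableTopology X]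
    [MeasurableSpace X] [OpensMeasurableSpace X] {f : X → F} (hf : Continuous f) :
    letI := A.measurableSpace
    Measurable fun p : X × A.Ω => ‖A.φ p.2 (A.info p.2 (f p.1)) - S (f p.1)‖ₑ := by
  let _ := A.measurableSpace
  have h1 : Measurable (Function.uncurry fun (x : X) (p : A.Ω × (Fin n → ℝ)) =>
      ‖A.φ p.1 p.2 - S (f x)‖) :=
    measurable_uncurry_of_continuous_of_measurable (fun p => by fun_prop)
      fun x => A.measurable_φ (S (f x))
  have h2 : Measurable fun p : X × A.Ω => A.info p.2 (f p.1) :=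
    measurable_pi_lambda _ fun k =>
      measurable_uncurry_of_continuous_of_measurable (u := fun (x : X) ω => A.L k ω (f x))
        (fun ω => (A.L k ω).continuous.comp hf) fun x => A.measurable_L k (f x)
  have h3 := (h1.comp (measurable_fst.prodMk (measurable_snd.prodMk h2))).ennreal_ofReal
  simpa only [Function.comp_def, Function.uncurry, ofReal_norm] using h3

/-- The algorithm which ignores an additional functional. -/
def succ (A : NonadaptiveAlgorithm.{w} F G n) : NonadaptiveAlgorithm.{w} F G (n + 1) :=
  letI := A.measurableSpace
  haveI := A.isProbabilityMeasure
  haveI := A.isComplete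
  { Ω := A.Ω
    P := A.P
    L := Fin.snoc (α := fun _ => A.Ω → (F →L[ℝ] ℝ)) A.L 0
    measurable_L := fun k f => by
      refine Fin.lastCases ?_ (fun k => ?_) k
      · simp
      · simpa using A.measurable_L k f
    φ := fun ω y => A.φ ω (Fin.init y)
    measurable_φ := fun g => (A.measurable_φ g).comp (measurable_fst.prodMk
      (measurable_pi_lambda _ fun k => (measurable_pi_apply k.castSucc).comp measurable_snd)) }

theorem errorAt_succ (A : NonadaptiveAlgorithm.{w} F G n) (S : F →L[ℝ] G) (f : F) :
    A.succ.errorAt S f = A.errorAt S f := by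
  have h : ∀ ω : A.Ω, A.succ.output ω f = A.output ω f := fun ω => by
    simp only [output, succ]
    congr 1
    funext k
    simp [Fin.init]
  simp only [errorAt]
  exact lintegral_congr fun ω => by rw [h ω]

/-- The algorithm without information and with output zero. -/
noncomputable def trivial : NonadaptiveAlgorithm.{w} F G 0 where
  Ω := PUnit
  measurableSpace := ⊤
  P := @Measure.dirac PUnit ⊤ PUnit.unit
  isProbabilityMeasure := @Measure.dirac.isProbabilityMeasure PUnit ⊤ PUnit.unit
  isComplete := ⟨fun _ _ => MeasurableSpace.measurableSet_top⟩
  L := fun _ _ => 0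
  measurable_L := fun k _ => k.elim0
  φ := fun _ _ => 0
  measurable_φ := fun _ => measurable_const

end NonadaptiveAlgorithm

theorem antitone_nonadaptiveRanError {F : Type u} {G : Type v} [NormedAddCommGroup F]
    [NormedSpace ℝ F] [NormedAddCommGroup G] [NormedSpace ℝ G] (S : F →L[ℝ] G) :
    Antitone (nonadaptiveRanError.{w} S) := by
  refine antitone_nat_of_succ_le fun n => le_iInf fun A => (iInf_le _ A.succ).trans ?_
  simp only [A.errorAt_succ, le_refl]

/-- Makes the limit a real number. -/
theorem nonadaptiveRanError_zero_ne_top {F : Type u} {G : Type v} [NormedAddCommGroup F]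
    [NormedSpace ℝ F] [NormedAddCommGroup G] [NormedSpace ℝ G] (S : F →L[ℝ] G) :
    nonadaptiveRanError.{w} S 0 ≠ ∞ := by
  refine ne_top_of_le_ne_top (b := ENNReal.ofReal ‖S‖) ENNReal.ofReal_ne_top
    ((iInf_le _ NonadaptiveAlgorithm.trivial).trans (iSup₂_le fun f hf => ?_))
  have hS : ‖S f‖ ≤ ‖S‖ := by
    simpa using (S.le_opNorm f).trans (mul_le_of_le_one_right (norm_nonneg S) hf)
  let _ : MeasurableSpace PUnit.{w + 1} := ⊤
  calc _ = ∫⁻ _ω, ‖(0 : G) - S f‖ₑ ∂(Measure.dirac PUnit.unit) := rfl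
    _ = ‖S f‖ₑ := by simp
    _ ≤ ENNReal.ofReal ‖S‖ := by
      rw [← ofReal_norm]
      exact ENNReal.ofReal_le_ofReal hS

/-! ### From fixed information maps to randomized algorithms. -/

/-- A number exceeding the mean error of a random reconstruction from `n` random functionals at all
points of the unit ball of `ℓ_1` is at least `1 / 32`. -/
theorem le_of_mean_error_le {n : ℕ} {Ω : Type*} [MeasurableSpace Ω] (P : Measure Ω)
    [IsProbabilityMeasure P] (T : Ω → lp (fun _ : ℕ => ℝ) 1 →ₗ[ℝ] (Fin n → ℝ))
    (g : Ω → (Fin n → ℝ) → lp (fun _ : ℕ => ℝ) ∞)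
    (hmeas : ∀ (k i : ℕ) (J : Fin k → ℕ), Measurable fun p : (Fin k → ℝ) × Ω =>
      ‖g p.2 (T p.2 (noisySpike i J p.1)) - l1EmbLinfty (noisySpike i J p.1)‖ₑ)
    {s : ℝ≥0∞} (hs : ∀ f, ‖f‖ ≤ 1 → ∫⁻ ω, ‖g ω (T ω f) - l1EmbLinfty f‖ₑ ∂P ≤ s) :
    1 / 32 ≤ s := by
  obtain ⟨k, m, hm, h⟩ := exists_le_sum_noiseError n
  have hswap : ∀ (i : ℕ) (J : Fin k → ℕ),
      Measurable (Function.uncurry fun (ω : Ω) (u : Fin k → ℝ) =>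
        ‖g ω (T ω (noisySpike i J u)) - l1EmbLinfty (noisySpike i J u)‖ₑ) := fun i J => by
    have := (hmeas k i J).comp (measurable_swap (α := Ω) (β := Fin k → ℝ))
    exact this
  have hsec : ∀ (ω : Ω) (i : ℕ) (J : Fin k → ℕ), Measurable fun u : Fin k → ℝ =>
      ‖g ω (T ω (noisySpike i J u)) - l1EmbLinfty (noisySpike i J u)‖ₑ := fun ω i J => by
    have := (hmeas k i J).comp (measurable_prodMk_right (y := ω))
    exact this
  have herr : ∀ z : Fin m × (Fin k → Fin m),
      Measurable fun ω => noiseError (T ω) (g ω) z.1 fun j => z.2 j := fun z => by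
    have := (hswap z.1 fun j => z.2 j).lintegral_prod_right'
      (ν := volume.restrict (Set.Icc (0 : Fin k → ℝ) 1))
    exact this
  have havg : ∀ (i : ℕ) (J : Fin k → ℕ), ∫⁻ ω, noiseError (T ω) (g ω) i J ∂P ≤ s := fun i J => by
    unfold noiseError
    -- Every noisy spike lies in the unit ball and the noise cube has volume 1, so the noise average
    -- inherits the bound `s`.
    rw [lintegral_lintegral_swap (hswap i J).aemeasurable]
    refine (setLIntegral_mono measurable_const fun u hu =>
      hs (noisySpike i J u) (norm_noisySpike_le i J hu)).trans ?_
    simp [Real.volume_Icc_pi]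
  set c : ℝ≥0∞ := ((m ^ (k + 1) : ℕ) : ℝ≥0∞) with hc
  have hmain : c * (1 / 32) ≤ c * s := by
    calc c * (1 / 32) = ∫⁻ _ω, c * (1 / 32) ∂P := by simp
      _ ≤ ∫⁻ ω, ∑ z : Fin m × (Fin k → Fin m), noiseError (T ω) (g ω) z.1 (fun j => z.2 j) ∂P :=
          lintegral_mono fun ω => h (T ω) (g ω) fun i J => hsec ω i J
      _ = ∑ z : Fin m × (Fin k → Fin m), ∫⁻ ω, noiseError (T ω) (g ω) z.1 (fun j => z.2 j) ∂P :=
          lintegral_finsetSum _ fun z _ => herr z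
      _ ≤ ∑ _z : Fin m × (Fin k → Fin m), s := Finset.sum_le_sum fun z _ => havg _ _
      _ = c * s := by
          rw [Finset.sum_const, nsmul_eq_mul, hc]
          simp [pow_succ, mul_comm]
  have hc0 : c ≠ 0 := Nat.cast_ne_zero.mpr (pow_pos hm _).ne'
  exact (ENNReal.mul_le_mul_iff_right hc0 (ENNReal.natCast_ne_top _)).mp hmain

theorem le_nonadaptiveRanError (n : ℕ) :
    1 / 32 ≤ nonadaptiveRanError.{w} l1EmbLinfty n := by
  refine le_iInf fun A => ?_
  let _ := A.measurableSpace
  have := A.isProbabilityMeasure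
  exact le_of_mean_error_le A.P A.info A.φ
    (fun k i J => A.measurable_error_comp l1EmbLinfty (continuous_noisySpike i J))
    fun f hf => le_iSup₂_of_le f hf le_rfl

theorem epsilonZero_pos : 0 < epsilonZero := by
  have h : (20 : ℝ) < Real.exp 4 := by
    rw [show (4 : ℝ) = ((4 : ℕ) : ℝ) * 1 by norm_num, Real.exp_nat_mul]
    calc (20 : ℝ) < 2.7 ^ 4 := by norm_num
      _ ≤ Real.exp 1 ^ 4 := by gcongr; linarith [Real.exp_one_gt_d9]
  have h2 : Real.exp (-4) < 1 / 20 := by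
    rw [Real.exp_neg, ← one_div]
    exact one_div_lt_one_div_of_lt (by norm_num) h
  unfold epsilonZero
  linarith

theorem epsilonZero_le : epsilonZero ≤ 1 / 32 := by
  have := Real.exp_pos (-4)
  unfold epsilonZero
  linarith

theorem corollary2p9 :
    (∃ l : ℝ,
      Tendsto (fun n : ℕ => nonadaptiveRanError.{w} l1EmbLinfty n) atTop (𝓝 (ENNReal.ofReal l)) ∧
      epsilonZero ≤ l) ∧
    0 < epsilonZero ∧
    ¬ IsApproximableNonadaptive.{w} l1EmbLinfty := by
  have hlim := tendsto_atTop_iInf (antitone_nonadaptiveRanError.{w} l1EmbLinfty)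
  have hle : 1 / 32 ≤ ⨅ n, nonadaptiveRanError.{w} l1EmbLinfty n :=
    le_iInf le_nonadaptiveRanError
  have htop : ⨅ n, nonadaptiveRanError.{w} l1EmbLinfty n ≠ ∞ :=
    ne_top_of_le_ne_top (nonadaptiveRanError_zero_ne_top _) (iInf_le _ 0)
  refine ⟨⟨_, by rwa [ENNReal.ofReal_toReal htop], epsilonZero_le.trans ?_⟩, epsilonZero_pos,
    fun h => ?_⟩
  · simpa using ENNReal.toReal_mono htop hle
  · rw [tendsto_nhds_unique hlim h] at hle
    simp at hle
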